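/- Let $\mathcal H$ be a complex Hilbert space, let $\mathcal P(\mathcal H)$ be the set of orthogonal projections on $\mathcal H$, and let $$\mathcal R=\{(P,f)\in\mathcal P(\mathcal H)\times\mathcal H : Pf=f,\ \|f\|=1\}$$ carry the topology inherited from $\mathcal B(\mathcal H)\times\mathcal H$, where the bounded operators $\mathcal B(\mathcal H)$ have the operator norm topology and $\mathcal H$ its norm topology. Call $P,P_0\in\mathcal P(\mathcal H)$ unitarily equivalent if $UPU^*=P_0$ for some unitary operator $U$ on $\mathcal H$, and put $$\mathcal R_{P_0}=\{(P,f)\in\mathcal R : P \text{ is unitarily equivalent to } P_0\},\qquad P_0\in\mathcal P(\mathcal H).$$ Then the connected components of $\mathcal R$ are exactly the sets $\mathcal R_{P_0}$ with $P_0\in\mathcal P(\mathcal H)$, $P_0\neq 0$. Moreover, for all $P_0,P_1\in\mathcal P(\mathcal H)$, one has $\mathcal R_{P_0}=\mathcal R_{P_1}$ if and only if $P_0$ and $P_1$ are unitarily equivalent. -/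

import Mathlib

noncomputable section

namespace SphereBundle

/-- The total space of the canonical sphere bundle over the orthogonal projections of `H`:
the pairs `(P, f)` with `P` an orthogonal projection, `P f = f` and `‖f‖ = 1`. As a subset of
`(H →L[ℂ] H) × H` it carries the topology given by the operator norm and the norm of `H`. -/
def totalSpace (H : Type*) [NormedAddCommGroup H] [InnerProductSpace ℂ H] [CompleteSpace H] :
    Set ((H →L[ℂ] H) × H) :=
  {x | IsStarProjection x.1 ∧ x.1 x.2 = x.2 ∧ ‖x.2‖ = 1}

/-- `P` and `Q` are unitarily equivalent: `U P U⋆ = Q` for some unitary operator `U` of `H`. -/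
def UnitarilyEquivalent {H : Type*} [NormedAddCommGroup H] [InnerProductSpace ℂ H]
    [CompleteSpace H] (P Q : H →L[ℂ] H) : Prop :=
  ∃ U : H →L[ℂ] H, U ∈ unitary (H →L[ℂ] H) ∧ U * P * star U = Q

/-- The pairs `(P, f)` of the total space with `P` unitarily equivalent to `P₀`. -/
def piece {H : Type*} [NormedAddCommGroup H] [InnerProductSpace ℂ H] [CompleteSpace H]
    (P₀ : H →L[ℂ] H) : Set (totalSpace H) :=
  {x | UnitarilyEquivalent x.1.1 P₀}

end SphereBundle

end

/-! Each piece is clopen and path connected. Openness: projections close in norm are unitarily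
conjugate (`eventually_exists_unitary_conj`). Connectedness: a path of unitaries moves `P` to any
equivalent projection (`joined_one`), and the fibre over `P` is the unit sphere of a nonzero complex
space (`joined_of_fst_eq`). For `joined_one`, `u` is split into two unitaries with nonnegative real
part, each close enough to `1` to be joined to it. -/

namespace SphereBundle

open Complex ContinuousLinearMap

section CStar

variable {A : Type*} [CStarAlgebra A] [PartialOrder A] [StarOrderedRing A]

/-- A unitary with nonnegative real part is at distance less than `2` from `1`. -/
lemma norm_sub_one_lt_two_of_add_star_nonneg {v : A} (hv : v ∈ unitary A)
    (h : 0 ≤ v + star v) : ‖v - 1‖ < 2 := by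
  have h1 : star (v - 1) * (v - 1) = 2 - (v + star v) := by
    have := Unitary.star_mul_self_of_mem hv
    rw [star_sub, star_one, sub_mul, mul_sub, mul_sub, this]
    simp only [mul_one, one_mul]
    rw [show (2 : A) = 1 + 1 from one_add_one_eq_two.symm]
    abel
  have h2 : ‖star (v - 1) * (v - 1)‖ ≤ ‖(2 : A)‖ :=
    CStarAlgebra.norm_le_norm_of_nonneg_of_le (star_mul_self_nonneg _)
      (by rw [h1]; exact sub_le_self _ h)
  rw [CStarRing.norm_star_mul_self] at h2
  have h3 : ‖(2 : A)‖ ≤ 2 := by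
    nontriviality A
    calc ‖(2 : A)‖ = ‖(1 : A) + 1‖ := by rw [one_add_one_eq_two]
      _ ≤ ‖(1 : A)‖ + ‖(1 : A)‖ := norm_add_le _ _
      _ = 2 := by rw [CStarRing.norm_one]; norm_num
  nlinarith [norm_nonneg (v - 1)]

lemma joined_one_of_add_star_nonneg {v : unitary A} (h : 0 ≤ (v : A) + star (v : A)) :
    Joined 1 v :=
  Unitary.joined 1 v (norm_sub_one_lt_two_of_add_star_nonneg v.2 h)

/-- The unitary polar factor of an invertible intertwiner of two selfadjoint elements
conjugates the one into the other. -/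
lemma exists_unitary_conj_of_isUnit {t p q : A} (ht : IsUnit t) (hp : IsSelfAdjoint p)
    (hq : IsSelfAdjoint q) (h : t * p = q * t) : ∃ u ∈ unitary A, u * p * star u = q := by
  set d : A := star t * t with hd
  have hd0 : 0 ≤ d := star_mul_self_nonneg t
  have hdu : IsUnit d := ht.star.mul ht
  have hdp : Commute d p := by
    have h' : p * star t = star t * q := by
      simpa [hp.star_eq, hq.star_eq] using congrArg star h
    change star t * t * p = p * (star t * t)
    rw [mul_assoc, h, ← mul_assoc, ← h', mul_assoc]
  -- `r` is `|t|⁻¹`, so `t * r` is the unitary polar factor.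
  set r : A := d ^ (-(1 / 2) : ℝ) with hr
  have hrs : star r = r := (IsSelfAdjoint.of_nonneg (CFC.rpow_nonneg)).star_eq
  have hru : IsUnit r := hdu.cfcRpow _ hd0
  have hrp : Commute r p := by
    rw [hr, CFC.rpow_def]; exact hdp.cfc_nnreal _
  have hrdr : r * d * r = 1 := by
    have h1 : d = d ^ (1 : ℝ) := (CFC.rpow_one d hd0).symm
    rw [hr]
    nth_rw 2 [h1]
    rw [← CFC.rpow_add hdu, ← CFC.rpow_add hdu]
    norm_num
    exact CFC.rpow_zero d hd0
  have hu1 : star (t * r) * (t * r) = 1 := by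
    rw [star_mul, hrs, ← hrdr, hd]; simp only [mul_assoc]
  have hu2 : t * r * star (t * r) = 1 := by
    obtain ⟨w, hw⟩ := ht.mul hru
    rw [← hw] at hu1 ⊢
    rw [← Units.mul_left_inj w, mul_assoc, hu1, mul_one, one_mul]
  refine ⟨t * r, Unitary.mem_iff.mpr ⟨hu1, hu2⟩, ?_⟩
  have : t * r * p = q * (t * r) := by
    rw [mul_assoc, hrp.eq, ← mul_assoc, h, mul_assoc]
  rw [this, mul_assoc, hu2, mul_one]

/-- Projections near a given projection are conjugate to it by a unitary. -/
lemma eventually_exists_unitary_conj {p : A} (hp : IsStarProjection p) :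
    ∀ᶠ q in nhds p, IsStarProjection q → ∃ u ∈ unitary A, u * p * star u = q := by
  -- This element intertwines `p` and `q` and equals `1` at `q = p`, hence is invertible nearby.
  have hc : Continuous fun q : A => q * p + (1 - q) * (1 - p) := by fun_prop
  have hpp : p * p = p := hp.isIdempotentElem
  have h1 : p * p + (1 - p) * (1 - p) = 1 := by
    rw [sub_mul, mul_sub, mul_sub, hpp]; simp
  have hev : ∀ᶠ q in nhds p, IsUnit (q * p + (1 - q) * (1 - p)) :=
    (Units.isOpen.preimage hc).mem_nhds (by simp [h1])
  filter_upwards [hev] with q hq hqs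
  have hqq : q * q = q := hqs.isIdempotentElem
  refine exists_unitary_conj_of_isUnit hq hp.isSelfAdjoint hqs.isSelfAdjoint ?_
  have e1 : (q * p + (1 - q) * (1 - p)) * p = q * p := by
    simp only [add_mul, mul_assoc, hpp, sub_mul, one_mul, sub_self, mul_zero, add_zero]
  have e2 : q * (q * p + (1 - q) * (1 - p)) = q * p := by
    simp only [mul_add, ← mul_assoc, hqq, mul_sub, mul_one, sub_self, zero_mul, add_zero]
  rw [e1, e2]

end CStar

variable {H : Type*} [NormedAddCommGroup H] [InnerProductSpace ℂ H] [CompleteSpace H]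

/-- The kernel is invariant under both `u` and `star u`, so it reduces `u`. -/
lemma commute_starProjection_ker {b u : H →L[ℂ] H}
    [(LinearMap.ker b.toLinearMap).HasOrthogonalProjection] (h : Commute b u)
    (h' : Commute b (star u)) :
    Commute (LinearMap.ker b.toLinearMap).starProjection u := by
  set K := LinearMap.ker b.toLinearMap
  set e := K.starProjection
  have he : star e = e := isSelfAdjoint_starProjection K
  have key : ∀ w : H →L[ℂ] H, Commute b w → e * (w * e) = w * e := by
    intro w hw
    ext x
    refine Submodule.starProjection_eq_self_iff.mpr ?_
    have hx : b (e x) = 0 := K.starProjection_apply_mem x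
    change b (w (e x)) = 0
    have h2 : b (w (e x)) = w (b (e x)) := congrArg (fun T : H →L[ℂ] H => T (e x)) hw.eq
    rw [h2, hx, map_zero]
  have h1 := key u h
  have h2 := congrArg star (key _ h')
  simp only [star_mul, star_star, he] at h2
  change e * u = u * e
  rw [← h1, ← h2, mul_assoc]

/-- The unitary group of a Hilbert space is path connected. -/
lemma joined_one (u : unitary (H →L[ℂ] H)) : Joined 1 u := by
  set a : H →L[ℂ] H := (u : H →L[ℂ] H) with ha
  have hu1 : star a * a = 1 := Unitary.coe_star_mul_self u
  have hu2 : a * star a = 1 := Unitary.coe_mul_star_self u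
  -- Twice the imaginary part of `u`.
  set b : H →L[ℂ] H := I • (star a - a) with hb
  have hbs : IsSelfAdjoint b := by
    rw [isSelfAdjoint_iff, hb, star_smul, star_sub, star_star]
    simp only [star_def, conj_I, neg_smul, ← smul_neg, neg_sub]
  have hba : Commute b a := by
    refine Commute.smul_left (Commute.sub_left ?_ (Commute.refl a)) _
    exact hu1.trans hu2.symm
  have hba' : Commute b (star a) := by
    refine Commute.smul_left (Commute.sub_left (Commute.refl _) ?_) _
    exact hu2.trans hu1.symm
  have hpa : ∀ w : H →L[ℂ] H, Commute b w → Commute b⁺ w := fun w hw => by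
    rw [CFC.posPart_def]; exact hw.cfcₙ_real _
  set e : H →L[ℂ] H := (LinearMap.ker (b⁺).toLinearMap).starProjection with hedef
  have he : star e = e := isSelfAdjoint_starProjection _
  have hee : e * e = e := (LinearMap.ker (b⁺).toLinearMap).isIdempotentElem_starProjection
  have hea : Commute e a := commute_starProjection_ker (hpa _ hba) (hpa _ hba')
  have hpe : b⁺ * e = 0 := by
    ext x
    exact (LinearMap.ker (b⁺).toLinearMap).starProjection_apply_mem x
  have hen : e * b⁻ = b⁻ := by
    ext x
    refine Submodule.starProjection_eq_self_iff.mpr ?_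
    change (b⁺ * b⁻) x = 0
    simp
  have hne : b⁻ * e = b⁻ := by
    have hn : star b⁻ = b⁻ := (IsSelfAdjoint.of_nonneg (CFC.negPart_nonneg b)).star_eq
    simpa [he, hn] using congrArg star hen
  -- A sign of `b`, with value `-1` on `ker b⁺`, so that `b * f = |b|`. Then `u = (u * star w) * w`
  -- with `w = I • f`: the real part of `w` is zero, that of `u * star w` is `|b| / 2`.
  set f : H →L[ℂ] H := 1 - 2 * e with hf
  have hfs : star f = f := by
    rw [hf, star_sub, star_mul, he, star_one, star_ofNat, two_mul, mul_two]
  have hff : f * f = 1 := by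
    simp only [hf, mul_sub, sub_mul, two_mul, add_mul, mul_add, hee, mul_one, one_mul]
    abel
  have hfa : Commute f a := by
    rw [hf, two_mul]
    exact (Commute.one_left a).sub_left (hea.add_left hea)
  have hfa' : Commute f (star a) := by
    have := hfa.star_star
    rwa [hfs] at this
  have hbf : b * f = b⁺ + b⁻ := by
    nth_rw 1 [← CFC.posPart_sub_negPart b hbs]
    simp only [hf, mul_sub, sub_mul, two_mul, mul_add, hpe, hne, mul_one]
    abel
  have hIf : I • f ∈ unitary (H →L[ℂ] H) := by
    rw [Unitary.mem_iff]
    simp [star_smul, hfs, smul_smul, hff]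
  set w : unitary (H →L[ℂ] H) := ⟨I • f, hIf⟩
  have hw : Joined 1 w := joined_one_of_add_star_nonneg (by simp [w, star_smul, hfs])
  have hv : Joined 1 (u * star w) := by
    refine joined_one_of_add_star_nonneg ?_
    have : ((u * star w : unitary (H →L[ℂ] H)) : H →L[ℂ] H)
        + star ((u * star w : unitary (H →L[ℂ] H)) : H →L[ℂ] H) = b⁺ + b⁻ := by
      rw [← hbf, hb]
      simp only [Submonoid.coe_mul, Unitary.coe_star, w, ← ha, star_mul, star_smul, star_def,
        conj_I, hfs, star_neg, mul_smul_comm, smul_mul_assoc, sub_mul, hfa'.eq]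
      module
    rw [this]
    exact add_nonneg (CFC.posPart_nonneg b) (CFC.negPart_nonneg b)
  have := hv.mul hw
  rwa [mul_one, mul_assoc, Unitary.star_mul_self, mul_one] at this

lemma UnitarilyEquivalent.refl (P : H →L[ℂ] H) : UnitarilyEquivalent P P :=
  ⟨1, one_mem _, by simp⟩

lemma UnitarilyEquivalent.symm {P Q : H →L[ℂ] H} (h : UnitarilyEquivalent P Q) :
    UnitarilyEquivalent Q P := by
  obtain ⟨U, hU, rfl⟩ := h
  refine ⟨star U, Unitary.star_mem hU, ?_⟩
  have := Unitary.star_mul_self_of_mem hU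
  rw [star_star, show star U * (U * P * star U) * U = (star U * U) * P * (star U * U) by
    simp only [mul_assoc], this, one_mul, mul_one]

lemma UnitarilyEquivalent.trans {P Q R : H →L[ℂ] H} (h : UnitarilyEquivalent P Q)
    (h' : UnitarilyEquivalent Q R) : UnitarilyEquivalent P R := by
  obtain ⟨U, hU, rfl⟩ := h
  obtain ⟨V, hV, rfl⟩ := h'
  exact ⟨V * U, mul_mem hV hU, by simp only [star_mul, mul_assoc]⟩

lemma conj_mem_totalSpace {x : (H →L[ℂ] H) × H} (hx : x ∈ totalSpace H)
    (u : unitary (H →L[ℂ] H)) :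
    ((u : H →L[ℂ] H) * x.1 * star (u : H →L[ℂ] H), (u : H →L[ℂ] H) x.2) ∈ totalSpace H := by
  obtain ⟨h1, h2, h3⟩ := hx
  have hu := Unitary.coe_star_mul_self u
  refine ⟨⟨?_, ?_⟩, ?_, ?_⟩
  · change _ * _ = _
    rw [show (u : H →L[ℂ] H) * x.1 * star (u : H →L[ℂ] H) * (u * x.1 * star (u : H →L[ℂ] H))
      = u * x.1 * (star (u : H →L[ℂ] H) * u) * x.1 * star (u : H →L[ℂ] H) by
      simp only [mul_assoc], hu, mul_one, mul_assoc (u : H →L[ℂ] H) x.1 x.1,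
      h1.isIdempotentElem.eq]
  · exact IsSelfAdjoint.conjugate h1.isSelfAdjoint (u : H →L[ℂ] H)
  · change ((u : H →L[ℂ] H) * x.1 * star (u : H →L[ℂ] H) * u) x.2 = (u : H →L[ℂ] H) x.2
    rw [mul_assoc, hu, mul_one]
    exact congrArg (u : H →L[ℂ] H) h2
  · change ‖(u : H →L[ℂ] H) x.2‖ = 1
    rw [norm_map_of_mem_unitary u.2, h3]

lemma joined_conj (x : totalSpace H) (u : unitary (H →L[ℂ] H)) :
    Joined x ⟨_, conj_mem_totalSpace x.2 u⟩ := by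
  have hc : Continuous fun v : unitary (H →L[ℂ] H) =>
      (⟨_, conj_mem_totalSpace x.2 v⟩ : totalSpace H) := by
    refine Continuous.subtype_mk (Continuous.prodMk ?_ ?_) _
    · fun_prop
    · exact continuous_subtype_val.clm_apply continuous_const
  have := (joined_one u).map hc
  have e : (⟨_, conj_mem_totalSpace x.2 1⟩ : totalSpace H) = x := by
    ext <;> simp
  rwa [e] at this

/-- The fibres of the sphere bundle are path connected. -/
lemma joined_of_fst_eq {x y : totalSpace H} (h : x.1.1 = y.1.1) : Joined x y := by
  obtain ⟨⟨P, f⟩, hP, hf, hf1⟩ := x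
  obtain ⟨⟨Q, g⟩, hQ, hg, hg1⟩ := y
  obtain rfl : P = Q := h
  dsimp only at hf hg hf1 hg1 hP
  set E := LinearMap.range P.toLinearMap
  let f' : E := ⟨f, f, hf⟩
  let g' : E := ⟨g, g, hg⟩
  have hfix : ∀ z : E, P z = z := by
    rintro ⟨_, w, rfl⟩
    exact congrArg (fun T : H →L[ℂ] H => T w) hP.isIdempotentElem.eq
  -- Spheres are path connected only from real dimension two on; a nonzero complex space has it.
  have hrank : 1 < Module.rank ℝ E := by
    have : Nontrivial E := ⟨⟨f', 0, fun h0 => by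
      have : f = 0 := congrArg Subtype.val h0
      simp [this] at hf1⟩⟩
    have h1 : 1 ≤ Module.rank ℂ E := Cardinal.one_le_iff_ne_zero.mpr rank_pos.ne'
    rw [rank_real_of_complex]
    calc (1 : Cardinal) < 2 := by norm_num
      _ = 2 * 1 := (mul_one _).symm
      _ ≤ 2 * Module.rank ℂ E := by gcongr
  have hs := (isPathConnected_sphere hrank (0 : E) zero_le_one).joinedIn f'
    (by simpa using hf1) g' (by simpa using hg1)
  have hc : Continuous fun z : Metric.sphere (0 : E) 1 =>
      (⟨(P, (z : H)), hP, hfix z, mem_sphere_zero_iff_norm.mp z.2⟩ : totalSpace H) := by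
    refine Continuous.subtype_mk (Continuous.prodMk ?_ ?_) _ <;> fun_prop
  exact hs.joined_subtype.map hc

lemma joined_of_unitarilyEquivalent {x y : totalSpace H}
    (h : UnitarilyEquivalent x.1.1 y.1.1) : Joined x y := by
  obtain ⟨U, hU, hUy⟩ := h
  exact (joined_conj x ⟨U, hU⟩).trans (joined_of_fst_eq hUy)

lemma isOpen_piece (P₀ : H →L[ℂ] H) : IsOpen (piece P₀) := by
  rw [isOpen_iff_mem_nhds]
  intro x hx
  have hc : Continuous fun y : totalSpace H => y.1.1 := by fun_prop
  filter_upwards [hc.continuousAt.eventually (eventually_exists_unitary_conj x.2.1)] with y hy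
  exact (UnitarilyEquivalent.symm (hy y.2.1)).trans hx

/-- The complement is a union of other pieces, all open. -/
lemma isClopen_piece (P₀ : H →L[ℂ] H) : IsClopen (piece P₀) := by
  refine ⟨isOpen_compl_iff.mp ?_, isOpen_piece P₀⟩
  rw [isOpen_iff_mem_nhds]
  intro x hx
  refine Filter.mem_of_superset
    ((isOpen_piece x.1.1).mem_nhds (UnitarilyEquivalent.refl x.1.1)) fun y hy hy' => hx ?_
  exact (UnitarilyEquivalent.symm hy).trans hy'

lemma connectedComponent_eq_piece {P₀ : H →L[ℂ] H} {x : totalSpace H} (hx : x ∈ piece P₀) :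
    connectedComponent x = piece P₀ := by
  refine ((isClopen_piece P₀).connectedComponent_subset hx).antisymm fun y hy => ?_
  exact pathComponent_subset_component x
    (joined_of_unitarilyEquivalent (UnitarilyEquivalent.trans hx (UnitarilyEquivalent.symm hy)))

lemma exists_mem_totalSpace {P : H →L[ℂ] H} (hP : IsStarProjection P) (h0 : P ≠ 0) :
    ∃ x : totalSpace H, x.1.1 = P := by
  obtain ⟨w, hw⟩ : ∃ w, P w ≠ 0 := by
    by_contra! h
    exact h0 (ContinuousLinearMap.ext h)
  have hPP : P (P w) = P w := congrArg (fun T : H →L[ℂ] H => T w) hP.isIdempotentElem.eq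
  refine ⟨⟨(P, ((‖P w‖⁻¹ : ℝ) : ℂ) • P w), hP, ?_, ?_⟩, rfl⟩
  · change P _ = _
    rw [map_smul, hPP]
  · have : ‖P w‖ ≠ 0 := norm_ne_zero_iff.mpr hw
    simp [norm_smul, this]

lemma fst_ne_zero (x : totalSpace H) : x.1.1 ≠ 0 := by
  intro h
  obtain ⟨-, h2, h3⟩ := x.2
  rw [h] at h2
  rw [← h2] at h3
  simp at h3

lemma piece_nonempty_iff {P₀ : H →L[ℂ] H} (hP : IsStarProjection P₀) :
    (piece P₀).Nonempty ↔ P₀ ≠ 0 := by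
  refine ⟨?_, fun h => ?_⟩
  · rintro ⟨x, hx⟩ rfl
    obtain ⟨U, -, hU⟩ := UnitarilyEquivalent.symm hx
    exact fst_ne_zero x (by simpa using hU.symm)
  · obtain ⟨x, rfl⟩ := exists_mem_totalSpace hP h
    exact ⟨x, UnitarilyEquivalent.refl _⟩

end SphereBundle

theorem mainTheorem7 (H : Type*) [NormedAddCommGroup H] [InnerProductSpace ℂ H]
    [CompleteSpace H] :
    (Set.range (fun x : SphereBundle.totalSpace H => connectedComponent x) =
      {C : Set (SphereBundle.totalSpace H) |
        ∃ P₀ : H →L[ℂ] H, IsStarProjection P₀ ∧ P₀ ≠ 0 ∧ C = SphereBundle.piece P₀}) ∧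
    (∀ P₀ P₁ : H →L[ℂ] H, IsStarProjection P₀ → IsStarProjection P₁ →
      (SphereBundle.piece P₀ = SphereBundle.piece P₁ ↔
        SphereBundle.UnitarilyEquivalent P₀ P₁)) := by
  refine ⟨?_, fun P₀ P₁ h₀ h₁ => ⟨fun h => ?_, fun h => ?_⟩⟩
  · ext C
    constructor
    · rintro ⟨x, rfl⟩
      exact ⟨x.1.1, x.2.1, SphereBundle.fst_ne_zero x,
        SphereBundle.connectedComponent_eq_piece (SphereBundle.UnitarilyEquivalent.refl _)⟩
    · rintro ⟨P₀, hP, h0, rfl⟩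
      obtain ⟨x, hx⟩ := (SphereBundle.piece_nonempty_iff hP).mpr h0
      exact ⟨x, SphereBundle.connectedComponent_eq_piece hx⟩
  -- The piece of `0` is empty, so there is no common point to compare through.
  · by_cases h0 : P₀ = 0
    · have h1 : P₁ = 0 := by
        by_contra h1
        exact (SphereBundle.piece_nonempty_iff h₀).mp
          (h ▸ (SphereBundle.piece_nonempty_iff h₁).mpr h1) h0
      rw [h0, h1]
      exact SphereBundle.UnitarilyEquivalent.refl 0
    · obtain ⟨x, hx⟩ := (SphereBundle.piece_nonempty_iff h₀).mpr h0
      have hx' : x ∈ SphereBundle.piece P₁ := h ▸ hx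
      exact (SphereBundle.UnitarilyEquivalent.symm hx).trans hx'
  · ext x
    exact ⟨fun hx => SphereBundle.UnitarilyEquivalent.trans hx h,
      fun hx => SphereBundle.UnitarilyEquivalent.trans hx h.symm⟩
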